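/- Theorem. Let $\mathfrak g$ be a finite-dimensional compact semisimple real Lie algebra (i.e. semisimple with negative definite Killing form), let $\theta_1\neq\mathrm{id}$ be an involutive automorphism of $\mathfrak g$, and fix an inner product $\langle\cdot,\cdot\rangle$ on $\mathfrak g$ invariant under all $e^{\operatorname{ad}Y}$, $Y\in\mathfrak g$. For an involution $\nu$ write $\mathfrak g^{\pm\nu}$ for its $(\pm1)$-eigenspaces. Let $\mathfrak a_1$ be a maximal abelian subspace of $\mathfrak g^{-\theta_1}$ and let $\Sigma$ be the set of nonzero $\lambda\in\mathfrak a_1$ for which there is $0\neq X\in\mathfrak g_{\mathbb C}=\mathfrak g\otimes_{\mathbb R}\mathbb C$ with $[A,X]=\sqrt{-1}\,\langle\lambda,A\rangle X$ for all $A\in\mathfrak a_1$. Put $$\Gamma=\{A\in\mathfrak a_1:\ \langle\lambda,A\rangle\in\tfrac{\pi}{2}\mathbb Z\ \text{ for all }\lambda\in\Sigma\}.$$ Let $Z_1\in\Gamma$ and $\theta_2:=e^{\operatorname{ad}Z_1}\theta_1e^{-\operatorname{ad}Z_1}$. Definitions. A real semisimple Lie algebra is non-compact if its Killing form is not negative definite.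 A Cartan involution of a real semisimple Lie algebra $\mathfrak g_0$ with Killing form $B$ is an involutive automorphism $\theta$ for which $-B(X,\theta Y)$ is positive definite. For an integer $m\ge 0$, a $\mathbb Z$-grading of the $m$-th kind of $\mathfrak g_0$ is a direct sum decomposition $\mathfrak g_0=\bigoplus_{k\in\mathbb Z}\mathfrak g_0(k)$ with $[\mathfrak g_0(k),\mathfrak g_0(l)]\subset\mathfrak g_0(k+l)$ for all $k,l$, with $\mathfrak g_0(\pm m)\ne0$ and with $\mathfrak g_0(k)=0$ for $|k|>m$. A pair $(Z,\theta)$ is associated with this grading if $\theta$ is a Cartan involution of $\mathfrak g_0$, $Z\in\mathfrak g_0$ satisfies $\theta(Z)=-Z$, and $\mathfrak g_0(k)=\{X\in\mathfrak g_0:[Z,X]=kX\}$ for all $k$; $Z$ is then called the characteristic element. Put $\sigma_Z:=e^{\pi\sqrt{-1}\operatorname{ad}Z}$. A pair $(\mathfrak g_0,\sigma)$ of a non-compact real semisimple Lie algebra and an involutive automorphism is of type $K_\varepsilon$ if, for some $m\ge1$, there is a $\mathbb Z$-grading of the $m$-th kind of $\mathfrak g_0$ with an associated pair $(Z,\theta)$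 such that $\sigma=\sigma_Z\theta$. Then: (1) $\theta_2$ is an involutive automorphism of $\mathfrak g$ commuting with $\theta_1$. Hence the dual $(\mathfrak g,\theta_1,\theta_2)^*:=(\mathfrak g_0,\sigma;\theta)$ is defined, where $\mathfrak g_0=\mathfrak g^{\theta_1}+\sqrt{-1}\,\mathfrak g^{-\theta_1}\subset\mathfrak g_{\mathbb C}$, and $\sigma$ and $\theta$ are the restrictions to $\mathfrak g_0$ of the $\mathbb C$-linear extensions of $\theta_2$ and $\theta_1$. (2) $(\mathfrak g_0,\sigma)$ is of type $K_\varepsilon$; in particular $\mathfrak g_0$ is semisimple and non-compact. (3) The element $Z=\frac{2Z_1}{\pi\sqrt{-1}}$ lies in $\mathfrak g_0$, and there is a $\mathbb Z$-grading of the $m$-th kind of $\mathfrak g_0$ for some $m\ge0$, with $m\ge1$ if $Z_1\ne0$, such that $(Z,\theta)$ is associated with it and $\sigma=\sigma_Z\theta$. -/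

import Mathlib

open scoped TensorProduct

noncomputable section

namespace SymTriad

/-! ### Exponentials of endomorphisms of finite-dimensional spaces -/

/-- The exponential `e^D = ∑ Dⁿ / n!` of an endomorphism of a finite-dimensional real or complex
vector space, computed in a basis (the result does not depend on the basis). -/
def expEnd (𝕜 : Type*) [RCLike 𝕜] {V : Type*} [AddCommGroup V] [Module 𝕜 V]
    [FiniteDimensional 𝕜 V] (D : V →ₗ[𝕜] V) : V →ₗ[𝕜] V :=
  Matrix.toLin (Module.finBasis 𝕜 V) (Module.finBasis 𝕜 V)
    (NormedSpace.exp (LinearMap.toMatrix (Module.finBasis 𝕜 V) (Module.finBasis 𝕜 V) D))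

section RealLie

variable (L : Type*) [LieRing L] [LieAlgebra ℝ L]

/-! ### Compact and non-compact semisimple Lie algebras, involutions -/

/-- A compact semisimple real Lie algebra: semisimple with negative definite Killing form. -/
def IsCompactSemisimple : Prop :=
  LieAlgebra.IsSemisimple ℝ L ∧ ∀ x : L, x ≠ 0 → killingForm ℝ L x x < 0

/-- A non-compact semisimple real Lie algebra. -/
def IsNoncompactSemisimple : Prop :=
  LieAlgebra.IsSemisimple ℝ L ∧ ¬ IsCompactSemisimple L

variable {L}

/-- Involutive automorphisms. -/
def IsInvolution (θ : L ≃ₗ⁅ℝ⁆ L) : Prop := ∀ x, θ (θ x) = x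

/-- A Cartan involution `θ`: the form `(x, y) ↦ -B(x, θ y)` is positive definite, where `B` is the
Killing form. -/
def IsCartanInvolution (θ : L ≃ₗ⁅ℝ⁆ L) : Prop :=
  IsInvolution θ ∧ ∀ x : L, x ≠ 0 → 0 < -killingForm ℝ L x (θ x)

/-- The `(-1)`-eigenspace `𝔤^{-θ}`. -/
def negEigenspace (θ : L ≃ₗ⁅ℝ⁆ L) : Submodule ℝ L where
  carrier := {x | θ x = -x}
  add_mem' {x y} hx hy := by
    simp only [Set.mem_ofPred_eq] at hx hy ⊢
    rw [map_add, hx, hy, neg_add]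
  zero_mem' := by simp
  smul_mem' c x hx := by
    simp only [Set.mem_ofPred_eq] at hx ⊢
    rw [map_smul, hx, smul_neg]

/-! ### Gradings and pairs of type `K_ε` -/

/-- A `ℤ`-grading of the `m`-th kind on `L`. -/
structure IsGradingOfKind (m : ℕ) (V : ℤ → Submodule ℝ L) : Prop where
  internal : DirectSum.IsInternal V
  lie_mem : ∀ k l : ℤ, ∀ x ∈ V k, ∀ y ∈ V l, ⁅x, y⁆ ∈ V (k + l)
  top_ne : V m ≠ ⊥
  bot_ne : V (-m) ≠ ⊥
  eq_bot : ∀ k : ℤ, (m : ℤ) < |k| → V k = ⊥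

/-- `(Z, θ)` is an associated pair of the grading `V`: `Z` is the characteristic element and
`θ` is a grade-reversing Cartan involution. -/
structure IsAssociatedPair (V : ℤ → Submodule ℝ L) (Z : L) (θ : L ≃ₗ⁅ℝ⁆ L) : Prop where
  mem_iff : ∀ (k : ℤ) (x : L), x ∈ V k ↔ ⁅Z, x⁆ = (k : ℝ) • x
  cartan : IsCartanInvolution θ
  reversing : θ Z = -Z

/-- The `ℂ`-linear operator `σ_Z = e^{π √-1 ad Z}` on the complexification of `L`. -/
def sigmaZ [FiniteDimensional ℝ L] (Z : L) : (ℂ ⊗[ℝ] L) →ₗ[ℂ] (ℂ ⊗[ℝ] L) :=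
  expEnd ℂ (((Real.pi : ℂ) * Complex.I) • LieAlgebra.ad ℂ (ℂ ⊗[ℝ] L) ((1 : ℂ) ⊗ₜ[ℝ] Z))

/-- The equality `σ = σ_Z θ` of maps on `L ⊆ ℂ ⊗ L`. -/
def EqSigmaZComp [FiniteDimensional ℝ L] (σ : L ≃ₗ⁅ℝ⁆ L) (Z : L) (θ : L ≃ₗ⁅ℝ⁆ L) : Prop :=
  ∀ x : L, (1 : ℂ) ⊗ₜ[ℝ] σ x = sigmaZ Z ((1 : ℂ) ⊗ₜ[ℝ] θ x)

variable (L) in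
/-- `(L, σ)` is a non-compact semisimple symmetric pair of type `K_ε`. -/
def IsTypeKEps [FiniteDimensional ℝ L] (σ : L ≃ₗ⁅ℝ⁆ L) : Prop :=
  IsNoncompactSemisimple L ∧ IsInvolution σ ∧
    ∃ (m : ℕ) (V : ℤ → Submodule ℝ L) (Z : L) (θ : L ≃ₗ⁅ℝ⁆ L),
      0 < m ∧ IsGradingOfKind m V ∧ IsAssociatedPair V Z θ ∧ EqSigmaZComp σ Z θ

/-! ### The complexification and the dual of a commutative compact triad -/

/-- The `ℂ`-linear extension of an automorphism to the complexification. -/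
def complexify (φ : L ≃ₗ⁅ℝ⁆ L) : (ℂ ⊗[ℝ] L) →ₗ[ℂ] (ℂ ⊗[ℝ] L) :=
  LinearMap.baseChange ℂ (φ : L →ₗ[ℝ] L)

variable (L) in
/-- The complex conjugation `μ` of the complexification with respect to `L`. -/
def conjugation : (ℂ ⊗[ℝ] L) →ₗ[ℝ] (ℂ ⊗[ℝ] L) :=
  LinearMap.rTensor L (Complex.conjAe.toLinearMap)

/- Brackets on the complexification are those of its Lie ring structure. -/
attribute [local instance] LieRing.toBracket

@[simp] lemma complexify_tmul (φ : L ≃ₗ⁅ℝ⁆ L) (z : ℂ) (x : L) :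
    complexify φ (z ⊗ₜ[ℝ] x) = z ⊗ₜ[ℝ] φ x := rfl

@[simp] lemma conjugation_tmul (z : ℂ) (x : L) :
    conjugation L (z ⊗ₜ[ℝ] x) = (starRingEnd ℂ z) ⊗ₜ[ℝ] x := rfl

lemma bracket_tmul' (z w : ℂ) (x y : L) :
    ⁅z ⊗ₜ[ℝ] x, w ⊗ₜ[ℝ] y⁆ = (z * w) ⊗ₜ[ℝ] ⁅x, y⁆ :=
  LieAlgebra.ExtendScalars.bracket_tmul ℝ ℂ L L z w x y

lemma lie_zero' (a : ℂ ⊗[ℝ] L) : ⁅a, (0 : ℂ ⊗[ℝ] L)⁆ = 0 :=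
  (LieAlgebra.ad ℂ (ℂ ⊗[ℝ] L) a).map_zero

lemma lie_add' (a b c : ℂ ⊗[ℝ] L) : ⁅a, b + c⁆ = ⁅a, b⁆ + ⁅a, c⁆ :=
  (LieAlgebra.ad ℂ (ℂ ⊗[ℝ] L) a).map_add b c

lemma complexify_lie (φ : L ≃ₗ⁅ℝ⁆ L) (a b : ℂ ⊗[ℝ] L) :
    complexify φ ⁅a, b⁆ = ⁅complexify φ a, complexify φ b⁆ := by
  induction a using TensorProduct.induction_on with
  | zero => simp
  | add a a' ha ha' => simp [add_lie, ha, ha']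
  | tmul z x =>
    induction b using TensorProduct.induction_on with
    | zero => rw [lie_zero', map_zero, lie_zero']
    | add b b' hb hb' => rw [lie_add', map_add, hb, hb', map_add, lie_add']
    | tmul w y => simp only [bracket_tmul', complexify_tmul, LieEquiv.map_lie]

lemma conjugation_lie (a b : ℂ ⊗[ℝ] L) :
    conjugation L ⁅a, b⁆ = ⁅conjugation L a, conjugation L b⁆ := by
  induction a using TensorProduct.induction_on with
  | zero => simp
  | add a a' ha ha' => simp [add_lie, ha, ha']
  | tmul z x =>
    induction b using TensorProduct.induction_on with
    | zero => rw [lie_zero', map_zero, lie_zero']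
    | add b b' hb hb' => rw [lie_add', map_add, hb, hb', map_add, lie_add']
    | tmul w y => simp only [bracket_tmul', conjugation_tmul, map_mul]

lemma complexify_conjugation (φ : L ≃ₗ⁅ℝ⁆ L) (a : ℂ ⊗[ℝ] L) :
    complexify φ (conjugation L a) = conjugation L (complexify φ a) := by
  induction a using TensorProduct.induction_on with
  | zero => simp
  | add a a' ha ha' => simp [ha, ha']
  | tmul z x => simp

lemma complexify_involutive {φ : L ≃ₗ⁅ℝ⁆ L} (h : IsInvolution φ) (a : ℂ ⊗[ℝ] L) :
    complexify φ (complexify φ a) = a := by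
  induction a using TensorProduct.induction_on with
  | zero => simp
  | add a a' ha ha' => simp [ha, ha']
  | tmul z x => simp [h x]

lemma complexify_comm {φ ψ : L ≃ₗ⁅ℝ⁆ L} (h : ∀ x, φ (ψ x) = ψ (φ x)) (a : ℂ ⊗[ℝ] L) :
    complexify φ (complexify ψ a) = complexify ψ (complexify φ a) := by
  induction a using TensorProduct.induction_on with
  | zero => simp
  | add a a' ha ha' => simp [ha, ha']
  | tmul z x => simp [h x]

/-- The fixed point set `𝔤₀ = 𝔤_ℂ^τ` of `τ = μ θ₁`, that is `𝔤^{θ₁} + √-1 𝔤^{-θ₁}`, as a real Lie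
subalgebra of the complexification. -/
def dualAlgebra (θ₁ : L ≃ₗ⁅ℝ⁆ L) : LieSubalgebra ℝ (ℂ ⊗[ℝ] L) where
  carrier := {x | conjugation L (complexify θ₁ x) = x}
  add_mem' {x y} hx hy := by
    simp only [Set.mem_ofPred_eq] at hx hy ⊢
    rw [map_add, map_add, hx, hy]
  zero_mem' := by simp
  smul_mem' c x hx := by
    simp only [Set.mem_ofPred_eq] at hx ⊢
    have h : complexify θ₁ (c • x) = c • complexify θ₁ x :=
      ((complexify θ₁).restrictScalars ℝ).map_smul c x
    rw [h, map_smul, hx]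
  lie_mem' {x y} hx hy := by
    change conjugation L (complexify θ₁ x) = x at hx
    change conjugation L (complexify θ₁ y) = y at hy
    change conjugation L (complexify θ₁ ⁅x, y⁆) = ⁅x, y⁆
    rw [complexify_lie, conjugation_lie, hx, hy]

instance (θ₁ : L ≃ₗ⁅ℝ⁆ L) [FiniteDimensional ℝ L] : FiniteDimensional ℝ (dualAlgebra θ₁) :=
  inferInstanceAs (FiniteDimensional ℝ (dualAlgebra θ₁).toSubmodule)

lemma mem_dualAlgebra {θ₁ : L ≃ₗ⁅ℝ⁆ L} {x : ℂ ⊗[ℝ] L} :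
    x ∈ dualAlgebra θ₁ ↔ conjugation L (complexify θ₁ x) = x := Iff.rfl

lemma complexify_mem {θ₁ φ : L ≃ₗ⁅ℝ⁆ L} (h : ∀ x, θ₁ (φ x) = φ (θ₁ x)) {x : ℂ ⊗[ℝ] L}
    (hx : x ∈ dualAlgebra θ₁) : complexify φ x ∈ dualAlgebra θ₁ := by
  rw [mem_dualAlgebra] at hx ⊢
  rw [complexify_comm h, ← complexify_conjugation, hx]

/-- The restriction to `𝔤₀` of the `ℂ`-linear extension of an involution `φ` commuting with
`θ₁`. -/
def dualRestrict (θ₁ φ : L ≃ₗ⁅ℝ⁆ L) (hφ : IsInvolution φ) (h : ∀ x, θ₁ (φ x) = φ (θ₁ x)) :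
    dualAlgebra θ₁ ≃ₗ⁅ℝ⁆ dualAlgebra θ₁ where
  toFun x := ⟨complexify φ x, complexify_mem h x.2⟩
  map_add' _ _ := Subtype.ext (map_add (complexify φ) _ _)
  map_smul' c _ := Subtype.ext (((complexify φ).restrictScalars ℝ).map_smul c _)
  map_lie' {_ _} := Subtype.ext (complexify_lie φ _ _)
  invFun x := ⟨complexify φ x, complexify_mem h x.2⟩
  left_inv _ := Subtype.ext (complexify_involutive hφ _)
  right_inv _ := Subtype.ext (complexify_involutive hφ _)

variable (L) in
/-- A commutative compact semisimple symmetric triad `(L, θ₁, θ₂)`. -/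
structure CommTriad where
  compact : IsCompactSemisimple L
  θ₁ : L ≃ₗ⁅ℝ⁆ L
  θ₂ : L ≃ₗ⁅ℝ⁆ L
  inv₁ : IsInvolution θ₁
  inv₂ : IsInvolution θ₂
  comm : ∀ x, θ₁ (θ₂ x) = θ₂ (θ₁ x)

/-! The dual `(L, θ₁, θ₂)^* = (𝔤₀, σ; θ)` of a commutative compact semisimple symmetric triad. -/

/-- The Lie algebra `𝔤₀ = 𝔤^{θ₁} + √-1 𝔤^{-θ₁}` of the dual. -/
abbrev CommTriad.dual (T : CommTriad L) : LieSubalgebra ℝ (ℂ ⊗[ℝ] L) := dualAlgebra T.θ₁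

/-- The involution `σ = θ₂|_{𝔤₀}` of the dual. -/
def CommTriad.dualσ (T : CommTriad L) : T.dual ≃ₗ⁅ℝ⁆ T.dual :=
  dualRestrict T.θ₁ T.θ₂ T.inv₂ T.comm

/-- The Cartan involution `θ = θ₁|_{𝔤₀}` of the dual. -/
def CommTriad.dualθ (T : CommTriad L) : T.dual ≃ₗ⁅ℝ⁆ T.dual :=
  dualRestrict T.θ₁ T.θ₁ T.inv₁ (fun _ => rfl)

/-! ### Restricted roots -/

/-- `e^{ad Y}`. -/
def expAd [FiniteDimensional ℝ L] (Y : L) : L →ₗ[ℝ] L := expEnd ℝ (LieAlgebra.ad ℝ L Y)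

/-- An inner product on `L` invariant under `Int L`, the group generated by all `e^{ad Y}`. -/
structure IsInvariantInner [FiniteDimensional ℝ L] (B : LinearMap.BilinForm ℝ L) : Prop where
  symm : ∀ x y, B x y = B y x
  pos : ∀ x, x ≠ 0 → 0 < B x x
  inv : ∀ Y x y, B (expAd Y x) (expAd Y y) = B x y

/-- `𝔞` is a maximal abelian subspace of `𝔭`. -/
def IsMaximalAbelianIn (𝔭 𝔞 : Submodule ℝ L) : Prop :=
  Maximal (fun 𝔟 : Submodule ℝ L => 𝔟 ≤ 𝔭 ∧ ∀ x ∈ 𝔟, ∀ y ∈ 𝔟, ⁅x, y⁆ = 0) 𝔞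

/-- The set `Σ` of restricted roots: the nonzero `l ∈ 𝔞` for which some nonzero `X` in the
complexification satisfies `[A, X] = √-1 ⟨l, A⟩ X` for all `A ∈ 𝔞`. -/
def restrictedRoots (B : LinearMap.BilinForm ℝ L) (𝔞 : Submodule ℝ L) : Set L :=
  {l | l ∈ 𝔞 ∧ l ≠ 0 ∧ ∃ X : ℂ ⊗[ℝ] L, X ≠ 0 ∧
    ∀ A ∈ 𝔞, LieAlgebra.ad ℂ (ℂ ⊗[ℝ] L) ((1 : ℂ) ⊗ₜ[ℝ] A) X = (Complex.I * (B l A : ℂ)) • X}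

/-- The lattice `Γ = {A ∈ 𝔞 : ⟨l, A⟩ ∈ (π/2) ℤ for all restricted roots l}`. -/
def latticeΓ (B : LinearMap.BilinForm ℝ L) (𝔞 : Submodule ℝ L) : Set L :=
  {A | A ∈ 𝔞 ∧ ∀ l ∈ restrictedRoots B 𝔞, ∃ n : ℤ, B l A = Real.pi / 2 * n}

end RealLie

end SymTriad

end

/-!
Write `𝔤 = 𝔨 + 𝔭` for the eigenspace decomposition of `θ₁`. The linear isomorphism `k + p ↦ k + √-1 p`
(`toDual`) carries `𝔤` to `𝔤₀`; under it `ad (k + √-1 p)` becomes `ad k + (ad p) θ₁`, and a trace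
computation gives `B₀(x, θ x) = B(k, k) + B(p, p) < 0`. So `θ` is a Cartan involution of `𝔤₀`
(`isCartanInvolution_dualRestrict`), which makes `𝔤₀` semisimple, and it is non-compact since
`θ₁ ≠ id` forces `𝔭 ≠ 0`.

The operators `ad a`, for `a` in the abelian subspace `𝔞₀ = √-1 𝔞₁` of the `(-1)`-eigenspace of `θ`,
commute and are self-adjoint for the inner product `-B₀(x, θ y)`, so they are simultaneously
diagonalizable over `ℝ`. A joint eigenvector in `𝔤₀ ⊆ 𝔤_ℂ` is a root vector for a restricted root, or
for `λ = 0`, and the condition defining `Γ` says exactly that `Z = 2 Z₁ / (π √-1)` has integral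
eigenvalues (`exists_int_of_mem_latticeΓ`). The eigenspaces of `ad Z` are then the grading
(`IsCartanInvolution.exists_grading`).

On the part of degree `k` of this grading, `ad Z₁` acts by `π √-1 k / 2`, and such parts span `𝔤_ℂ`
over `ℂ`. Evaluating on them shows that `e^{ad Z₁}` is an automorphism, that
`θ₂ = e^{ad Z₁} θ₁ e^{-ad Z₁}` equals `e^{-π √-1 k} θ₁ = (-1)^k θ₁` in degree `k`, hence that `θ₂`
commutes with `θ₁` and that `σ = σ_Z θ`.

If `Z₁ = 0` then this grading is trivial, `σ = θ`, and type `K_ε` needs another grading, all of whose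
degrees are even. A restricted root vector `e ∈ 𝔤₀` spans with `θ e` and `[e, θ e]` an
`𝔰𝔩₂`-triple whose middle element `h` has integral eigenvalues
(`IsCartanInvolution.exists_integral`), and `2 h` is the characteristic element of such a grading.
-/

open scoped TensorProduct

noncomputable section

namespace SymTriad

/-! ### Exponentials on eigenvectors -/

section Exponential

attribute [local instance] Matrix.linftyOpNormedRing Matrix.linftyOpNormedAlgebra

lemma exp_mulVec_of_mulVec_eq {n : Type*} [Fintype n] [DecidableEq n] (M : Matrix n n ℂ) {c : ℂ}
    {v : n → ℂ} (h : M.mulVec v = c • v) :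
    (NormedSpace.exp M).mulVec v = Complex.exp c • v := by
  have hpow (k : ℕ) : (M ^ k).mulVec v = c ^ k • v := by
    induction k with
    | zero => simp
    | succ k ih => rw [pow_succ, ← Matrix.mulVec_mulVec, h, Matrix.mulVec_smul, ih, smul_smul,
        pow_succ, mul_comm]
  have h1 := NormedSpace.exp_series_hasSum_exp' (𝕂 := ℂ) M
  let ev : Matrix n n ℂ →ₗ[ℂ] (n → ℂ) :=
    { toFun := fun A => A.mulVec v
      map_add' := fun A A' => Matrix.add_mulVec A A' v
      map_smul' := fun a A => Matrix.smul_mulVec a A v }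
  have h2 := h1.mapL (LinearMap.toContinuousLinearMap ev)
  have h3 := NormedSpace.exp_series_hasSum_exp' (𝕂 := ℂ) c
  have h4 := h3.smul_const v
  rw [← Complex.exp_eq_exp_ℂ] at h4
  have hterm : (fun k : ℕ => LinearMap.toContinuousLinearMap ev ((k.factorial : ℂ)⁻¹ • M ^ k)) =
      fun k : ℕ => ((k.factorial : ℂ)⁻¹ • c ^ k) • v := by
    funext k
    change ((k.factorial : ℂ)⁻¹ • M ^ k).mulVec v = _
    rw [Matrix.smul_mulVec, hpow, smul_assoc]
  rw [hterm] at h2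
  exact h2.unique h4

lemma exp_map_ofReal {n : Type*} [Fintype n] [DecidableEq n] (M : Matrix n n ℝ) :
    (NormedSpace.exp M).map Complex.ofReal = NormedSpace.exp (M.map Complex.ofReal) := by
  have hc : Continuous (Complex.ofRealHom.mapMatrix : Matrix n n ℝ →+* Matrix n n ℂ) :=
    Continuous.matrix_map continuous_id Complex.continuous_ofReal
  exact NormedSpace.map_exp (Complex.ofRealHom.mapMatrix : Matrix n n ℝ →+* Matrix n n ℂ) hc M

lemma expEnd_apply_of_apply_eq {V : Type*} [AddCommGroup V] [Module ℂ V] [FiniteDimensional ℂ V]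
    (D : V →ₗ[ℂ] V) {c : ℂ} {v : V} (h : D v = c • v) :
    expEnd ℂ D v = Complex.exp c • v := by
  set b := Module.finBasis ℂ V
  apply b.repr.injective
  apply DFunLike.coe_injective
  rw [expEnd, Matrix.repr_toLin, map_smul, Finsupp.coe_smul]
  apply exp_mulVec_of_mulVec_eq
  rw [LinearMap.toMatrix_mulVec_repr, h, map_smul, Finsupp.coe_smul]

/-- The complexified exponential of a real endomorphism acts by `e^c` on a complex eigenvector
for the eigenvalue `c`. -/
lemma baseChange_expEnd_apply_of_apply_eq {V : Type*} [AddCommGroup V] [Module ℝ V]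
    [FiniteDimensional ℝ V] (D : V →ₗ[ℝ] V) {c : ℂ} {v : ℂ ⊗[ℝ] V}
    (h : D.baseChange ℂ v = c • v) :
    (expEnd ℝ D).baseChange ℂ v = Complex.exp c • v := by
  set b := Module.finBasis ℝ V
  set b' := Algebra.TensorProduct.basis ℂ b
  apply b'.repr.injective
  apply DFunLike.coe_injective
  have h1 : LinearMap.toMatrix b' b' ((expEnd ℝ D).baseChange ℂ)
      = NormedSpace.exp (LinearMap.toMatrix b' b' (D.baseChange ℂ)) := by
    rw [LinearMap.toMatrix_baseChange, LinearMap.toMatrix_baseChange, expEnd,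
      LinearMap.toMatrix_toLin]
    exact exp_map_ofReal _
  rw [← LinearMap.toMatrix_mulVec_repr b' b', h1, map_smul, Finsupp.coe_smul]
  apply exp_mulVec_of_mulVec_eq
  rw [LinearMap.toMatrix_mulVec_repr, h, map_smul, Finsupp.coe_smul]

end Exponential

/-! ### Real Lie algebras with a Cartan involution -/

/-- Commuting endomorphisms that are self-adjoint for a positive definite form are simultaneously
diagonalizable. -/
lemma iSup_iInf_eigenspace_eq_top {V ι : Type*} [AddCommGroup V] [Module ℝ V]
    [FiniteDimensional ℝ V] (b : LinearMap.BilinForm ℝ V) (hsymm : ∀ x y, b x y = b y x)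
    (hpos : ∀ x, x ≠ 0 → 0 < b x x) (T : ι → V →ₗ[ℝ] V)
    (hT : ∀ i x y, b (T i x) y = b x (T i y)) (hcomm : ∀ i j, Commute (T i) (T j)) :
    ⨆ χ : ι → ℝ, ⨅ i, Module.End.eigenspace (T i) (χ i) = ⊤ := by
  let core : InnerProductSpace.Core ℝ V :=
    { inner := fun x y => b x y
      conj_inner_symm := fun x y => hsymm y x
      re_inner_nonneg := fun x => by
        rcases eq_or_ne x 0 with rfl | hx
        · simp
        · exact (hpos x hx).le
      add_left := fun x y z => by simp
      smul_left := fun x y r => by simp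
      definite := fun x hx => by
        by_contra h
        exact (hpos x h).ne' hx }
  let _ : NormedAddCommGroup V := core.toNormedAddCommGroup
  let _ : InnerProductSpace ℝ V := InnerProductSpace.ofCore core.toCore
  exact LinearMap.IsSymmetric.iSup_iInf_eq_top_of_commute (T := T) (fun i x y => hT i x y)
    (fun i j _ => hcomm i j)

section Cartan

variable {H : Type*} [LieRing H] [LieAlgebra ℝ H] {θ : H ≃ₗ⁅ℝ⁆ H}

lemma IsCartanInvolution.eq_zero_of_killingForm_eq_zero (hθ : IsCartanInvolution θ) {x : H}
    (hx : ∀ y, killingForm ℝ H x y = 0) : x = 0 := by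
  by_contra h
  have := hθ.2 x h
  rw [hx, neg_zero] at this
  exact this.false

lemma IsCartanInvolution.isSemisimple [FiniteDimensional ℝ H] (hθ : IsCartanInvolution θ) :
    LieAlgebra.IsSemisimple ℝ H := by
  have : LieAlgebra.IsKilling ℝ H := by
    constructor
    rw [eq_bot_iff]
    intro x hx
    rw [LieIdeal.mem_killingCompl] at hx
    rw [LieSubmodule.mem_bot]
    refine hθ.eq_zero_of_killingForm_eq_zero fun y => ?_
    rw [LieModule.traceForm_comm]
    exact hx y trivial
  infer_instance

lemma IsCartanInvolution.isNoncompactSemisimple [FiniteDimensional ℝ H]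
    (hθ : IsCartanInvolution θ) {x : H} (hx0 : x ≠ 0) (hx : θ x = -x) :
    IsNoncompactSemisimple H := by
  refine ⟨hθ.isSemisimple, fun hc => ?_⟩
  have h1 := hθ.2 x hx0
  rw [hx, map_neg, neg_neg] at h1
  exact (hc.2 x hx0).asymm h1

lemma IsCartanInvolution.eq_zero_of_lie_eq_zero (hθ : IsCartanInvolution θ) {x : H}
    (hx : ∀ y : H, ⁅x, y⁆ = 0) : x = 0 := by
  refine hθ.eq_zero_of_killingForm_eq_zero fun y => ?_
  have : LieAlgebra.ad ℝ H x = 0 := LinearMap.ext hx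
  rw [killingForm_apply_apply, this, LinearMap.zero_comp, map_zero]

lemma lie_apply_eq_neg_smul_of_lie_eq_smul {x y : H} {c : ℝ}
    (hx : θ x = -x) (hy : ⁅x, y⁆ = c • y) : ⁅x, θ y⁆ = (-c) • θ y := by
  have := congrArg θ hy
  rw [LieEquiv.map_lie, hx, map_smul, neg_lie] at this
  rw [neg_smul, ← this, neg_neg]

/-- An abelian subspace `𝔞` of the `(-1)`-eigenspace of a Cartan involution `θ` is simultaneously
diagonalizable in the adjoint representation: `ad a`, for `a ∈ 𝔞`, is self-adjoint for the inner
product `-B(x, θ y)`. -/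
lemma IsCartanInvolution.iSup_iInf_eigenspace_ad_eq_top [FiniteDimensional ℝ H]
    (hθ : IsCartanInvolution θ) {𝔞 : Submodule ℝ H} (hneg : ∀ a ∈ 𝔞, θ a = -a)
    (habel : ∀ a ∈ 𝔞, ∀ b ∈ 𝔞, ⁅a, b⁆ = 0) :
    ⨆ χ : 𝔞 → ℝ, ⨅ a : 𝔞, Module.End.eigenspace (LieAlgebra.ad ℝ H (a : H)) (χ a) = ⊤ := by
  let b : LinearMap.BilinForm ℝ H := -(killingForm ℝ H).compl₂ (θ : H →ₗ[ℝ] H)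
  have hb (x y : H) : b x y = -killingForm ℝ H x (θ y) := rfl
  refine iSup_iInf_eigenspace_eq_top b (fun x y => ?_) (fun x hx => hθ.2 x hx) _
    (fun a x y => ?_) (fun a a' => ?_)
  · rw [hb, hb, ← LieAlgebra.killingForm_of_equiv_apply θ y, hθ.1,
      LieModule.traceForm_comm]
  · rw [hb, hb, LieAlgebra.ad_apply, LieAlgebra.ad_apply, LieModule.traceForm_apply_lie_apply',
      LieEquiv.map_lie, hneg a a.2, neg_lie, map_neg]
  · ext x
    have h := leibniz_lie (a : H) (a' : H) x
    rw [habel _ a.2 _ a'.2, zero_lie, zero_add] at h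
    exact h

/-- If an element `Z` of an abelian subspace `𝔞` of the `(-1)`-eigenspace takes integral values at
all weights of `𝔞`, then the eigenspaces of `ad Z` for integral eigenvalues span. -/
lemma IsCartanInvolution.iSup_eigenspace_int_eq_top [FiniteDimensional ℝ H]
    (hθ : IsCartanInvolution θ) {𝔞 : Submodule ℝ H} (hneg : ∀ a ∈ 𝔞, θ a = -a)
    (habel : ∀ a ∈ 𝔞, ∀ b ∈ 𝔞, ⁅a, b⁆ = 0) {Z : H} (hZ : Z ∈ 𝔞)
    (hint : ∀ (χ : 𝔞 → ℝ) (y : H), y ≠ 0 → (∀ a : 𝔞, ⁅(a : H), y⁆ = χ a • y) →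
      ∃ n : ℤ, χ ⟨Z, hZ⟩ = n) :
    ⨆ k : ℤ, Module.End.eigenspace (LieAlgebra.ad ℝ H Z) (k : ℝ) = ⊤ := by
  rw [eq_top_iff, ← hθ.iSup_iInf_eigenspace_ad_eq_top hneg habel]
  refine iSup_le fun χ y hy => ?_
  rcases eq_or_ne y 0 with rfl | hy0
  · exact zero_mem _
  have hy' (a : 𝔞) : ⁅(a : H), y⁆ = χ a • y :=
    Module.End.mem_eigenspace_iff.1 ((Submodule.mem_iInf _).1 hy a)
  obtain ⟨n, hn⟩ := hint χ y hy0 hy'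
  refine Submodule.mem_iSup_of_mem n (Module.End.mem_eigenspace_iff.2 ?_)
  rw [← hn]
  exact hy' ⟨Z, hZ⟩

/-- An element `Z` of the `(-1)`-eigenspace of a Cartan involution such that `ad Z` is
diagonalizable with integral eigenvalues is the characteristic element of a grading. -/
lemma IsCartanInvolution.exists_grading [FiniteDimensional ℝ H] [Nontrivial H]
    (hθ : IsCartanInvolution θ) {Z : H} (hZ : θ Z = -Z)
    (htop : ⨆ k : ℤ, Module.End.eigenspace (LieAlgebra.ad ℝ H Z) (k : ℝ) = ⊤) :
    ∃ (m : ℕ) (V : ℤ → Submodule ℝ H),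
      (Z ≠ 0 → 0 < m) ∧ IsGradingOfKind m V ∧ IsAssociatedPair V Z θ := by
  set D := LieAlgebra.ad ℝ H Z
  let V : ℤ → Submodule ℝ H := fun k => Module.End.eigenspace D (k : ℝ)
  have hV (k : ℤ) (x : H) : x ∈ V k ↔ ⁅Z, x⁆ = (k : ℝ) • x := Module.End.mem_eigenspace_iff
  change ⨆ k, V k = ⊤ at htop
  have hindep : iSupIndep V :=
    (Module.End.eigenspaces_iSupIndep D).comp (Int.cast_injective (α := ℝ))
  have hrefl {k : ℤ} (hk : V k ≠ ⊥) : V (-k) ≠ ⊥ := by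
    obtain ⟨y, hy, hy0⟩ := (Submodule.ne_bot_iff _).1 hk
    refine (Submodule.ne_bot_iff _).2 ⟨θ y, (hV _ _).2 ?_, fun h => hy0 ?_⟩
    · rw [lie_apply_eq_neg_smul_of_lie_eq_smul hZ ((hV _ _).1 hy), Int.cast_neg]
    · rw [← hθ.1 y, h, map_zero]
  have hfin : {k : ℤ | V k ≠ ⊥}.Finite := WellFoundedGT.finite_ne_bot_of_iSupIndep hindep
  have hne : {k : ℤ | V k ≠ ⊥}.Nonempty := by
    by_contra h
    rw [Set.not_nonempty_iff_eq_empty] at h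
    have h0 (k : ℤ) : V k = ⊥ := by
      by_contra hk
      exact (h ▸ (show k ∈ {k : ℤ | V k ≠ ⊥} from hk) : k ∈ (∅ : Set ℤ))
    simp only [h0, iSup_bot] at htop
    exact bot_ne_top htop
  -- The kind is the largest absolute value of a degree that occurs.
  obtain ⟨k₀, hk₀, hmax⟩ := Set.exists_max_image _ Int.natAbs hfin hne
  refine ⟨k₀.natAbs, V, fun hZ0 => ?_, ⟨?_, ?_, ?_, ?_, ?_⟩, ⟨hV, hθ, hZ⟩⟩
  · by_contra hm
    refine hZ0 (hθ.eq_zero_of_lie_eq_zero fun y => ?_)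
    have hV0 : V 0 = ⊤ := by
      rw [eq_top_iff, ← htop]
      refine iSup_le fun k => ?_
      by_cases hk : V k = ⊥
      · rw [hk]; exact bot_le
      · have := hmax k hk
        rw [show k = 0 by omega]
    have := (hV 0 y).1 (hV0 ▸ trivial)
    rw [this, Int.cast_zero, zero_smul]
  · exact (DirectSum.isInternal_submodule_iff_iSupIndep_and_iSup_eq_top _).2 ⟨hindep, htop⟩
  · intro k l x hx y hy
    rw [hV] at hx hy ⊢
    rw [leibniz_lie, hx, hy, smul_lie, lie_smul, ← add_smul, Int.cast_add]
  · rcases Int.natAbs_eq k₀ with h | h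
    · rw [← h]; exact hk₀
    · rw [← neg_eq_iff_eq_neg] at h
      rw [← h]; exact hrefl hk₀
  · rcases Int.natAbs_eq k₀ with h | h
    · rw [← h]; exact hrefl hk₀
    · rw [← h]; exact hk₀
  · intro k hk
    by_contra hk'
    have := hmax k hk'
    rw [Int.abs_eq_natAbs] at hk
    omega

/-- In a finite-dimensional representation, the middle element of an `𝔰𝔩₂`-triple has integral
eigenvalues: raising an eigenvector reaches a primitive vector. -/
lemma _root_.IsSl2Triple.exists_int_of_lie_eq_smul [FiniteDimensional ℝ H] {h e f : H}
    (t : IsSl2Triple h e f) {c : ℝ} {y : H} (hy0 : y ≠ 0) (hy : ⁅h, y⁆ = c • y) :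
    ∃ n : ℤ, c = n := by
  set E := LieAlgebra.ad ℝ H e
  have hE (n : ℕ) : ⁅h, (E ^ n) y⁆ = (c + 2 * n) • (E ^ n) y := by
    induction n with
    | zero => simpa using hy
    | succ n ih =>
      rw [pow_succ', Module.End.mul_apply, LieAlgebra.ad_apply, leibniz_lie, t.lie_h_e_smul ℝ, ih,
        smul_lie, lie_smul, ← add_smul, Nat.cast_add, Nat.cast_one]
      congr 1
      ring
  have hex : ∃ n : ℕ, (E ^ n) y = 0 := by
    by_contra! hne
    have hinj : Function.Injective fun n : ℕ => c + 2 * (n : ℝ) := fun n m hnm => by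
      simpa using hnm
    have hli := Module.End.eigenvectors_linearIndependent' (LieAlgebra.ad ℝ H h) _ hinj
      (fun n => (E ^ n) y) fun n => ⟨Module.End.mem_eigenspace_iff.2 (hE n), hne n⟩
    have := hli.finite
    exact not_finite ℕ
  obtain ⟨n, hn, hn'⟩ := Nat.exists_not_and_succ_of_not_zero_of_exists (p := fun n => (E ^ n) y = 0)
    (by simpa using hy0) hex
  have hprim : t.HasPrimitiveVectorWith ((E ^ n) y) (c + 2 * n) :=
    ⟨hn, hE n, by rw [pow_succ', Module.End.mul_apply] at hn'; exact hn'⟩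
  obtain ⟨k, hk⟩ := hprim.exists_nat
  exact ⟨k - 2 * n, by push_cast; linarith⟩

/-- The `(-1)`-eigenspace of a Cartan involution, if it has a nonzero maximal abelian subspace `𝔞`,
contains a nonzero element whose adjoint action has integral eigenvalues: the coroot of a restricted
root, which is the middle element of an `𝔰𝔩₂`-triple spanned by `e`, `θ e` and `[e, θ e]` for a
restricted root vector `e`. -/
lemma IsCartanInvolution.exists_integral [FiniteDimensional ℝ H]
    (hθ : IsCartanInvolution θ) {𝔞 : Submodule ℝ H} (hneg : ∀ a ∈ 𝔞, θ a = -a)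
    (habel : ∀ a ∈ 𝔞, ∀ b ∈ 𝔞, ⁅a, b⁆ = 0)
    (hmax : ∀ x, θ x = -x → (∀ a ∈ 𝔞, ⁅a, x⁆ = 0) → x ∈ 𝔞) (hne : 𝔞 ≠ ⊥) :
    ∃ h ∈ 𝔞, h ≠ 0 ∧ ∀ (c : ℝ) (y : H), y ≠ 0 → ⁅h, y⁆ = c • y → ∃ n : ℤ, c = n := by
  have htop := hθ.iSup_iInf_eigenspace_ad_eq_top hneg habel
  obtain ⟨a₀, ha₀, ha₀0⟩ := (Submodule.ne_bot_iff _).1 hne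
  obtain ⟨χ, e, he0, he, hχ⟩ : ∃ (χ : 𝔞 → ℝ) (e : H), e ≠ 0 ∧ (∀ a : 𝔞, ⁅(a : H), e⁆ = χ a • e) ∧
      χ ⟨a₀, ha₀⟩ ≠ 0 := by
    by_contra! hcon
    refine ha₀0 (hθ.eq_zero_of_lie_eq_zero fun y => ?_)
    have hle : (⊤ : Submodule ℝ H) ≤ LinearMap.ker (LieAlgebra.ad ℝ H a₀) := by
      rw [← htop]
      refine iSup_le fun χ e he => ?_
      rw [LinearMap.mem_ker, LieAlgebra.ad_apply]
      rcases eq_or_ne e 0 with rfl | he0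
      · exact lie_zero _
      have he' (a : 𝔞) : ⁅(a : H), e⁆ = χ a • e :=
        Module.End.mem_eigenspace_iff.1 ((Submodule.mem_iInf _).1 he a)
      rw [he' ⟨a₀, ha₀⟩, hcon χ e he0 he', zero_smul]
    exact hle (x := y) trivial
  have hθe (a : 𝔞) := lie_apply_eq_neg_smul_of_lie_eq_smul (hneg a a.2) (he a)
  set h₀ := ⁅e, θ e⁆
  have hθh₀ : θ h₀ = -h₀ := by
    rw [LieEquiv.map_lie, hθ.1, lie_skew]
  have hh₀ : h₀ ∈ 𝔞 := by
    refine hmax _ hθh₀ fun a ha => ?_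
    rw [leibniz_lie, he ⟨a, ha⟩, hθe ⟨a, ha⟩, smul_lie, lie_smul, ← add_smul, add_neg_cancel,
      zero_smul]
  have hK (a : 𝔞) : killingForm ℝ H a h₀ = χ a * killingForm ℝ H e (θ e) := by
    rw [← LieModule.traceForm_apply_lie_apply, he, map_smul, LinearMap.smul_apply, smul_eq_mul]
  have hBe := hθ.2 e he0
  have hh₀0 : h₀ ≠ 0 := by
    intro h
    have := hK ⟨a₀, ha₀⟩
    rw [h, map_zero] at this
    rcases mul_eq_zero.1 this.symm with h1 | h1
    · exact hχ h1
    · rw [h1] at hBe; simp at hBe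
  have hBh := hθ.2 h₀ hh₀0
  rw [hθh₀, map_neg, neg_neg, hK ⟨h₀, hh₀⟩] at hBh
  set c₀ := χ ⟨h₀, hh₀⟩
  have hc₀ : c₀ ≠ 0 := by
    intro h
    rw [h, zero_mul] at hBh
    exact hBh.false
  -- The scaling that turns `h₀, e, θ e` into an `𝔰𝔩₂`-triple.
  have ht : IsSl2Triple ((2 / c₀) • h₀) e ((2 / c₀) • θ e) := by
    refine ⟨smul_ne_zero (div_ne_zero two_ne_zero hc₀) hh₀0, lie_smul _ _ _, ?_, ?_⟩
    · rw [smul_lie, he ⟨h₀, hh₀⟩, smul_smul, div_mul_cancel₀ _ hc₀, two_smul, two_smul]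
    · rw [smul_lie, lie_smul, hθe ⟨h₀, hh₀⟩, smul_smul, smul_smul, ← smul_assoc, ← neg_smul]
      congr 1
      change 2 / c₀ * (2 / c₀) * -c₀ = _
      rw [two_nsmul]
      field_simp
      ring
  exact ⟨_, 𝔞.smul_mem _ hh₀, ht.h_ne_zero, fun c y hy0 hy => ht.exists_int_of_lie_eq_smul hy0 hy⟩

end Cartan

section Dual

variable {L : Type*} [LieRing L] [LieAlgebra ℝ L]

attribute [local instance] LieRing.toBracket

/-! ### Real and imaginary parts in the complexification -/

variable (L) in
/-- The real part of an element of the complexification. -/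
def rePart : (ℂ ⊗[ℝ] L) →ₗ[ℝ] L :=
  TensorProduct.lid ℝ L ∘ₗ LinearMap.rTensor L Complex.reLm

variable (L) in
/-- The imaginary part of an element of the complexification. -/
def imPart : (ℂ ⊗[ℝ] L) →ₗ[ℝ] L :=
  TensorProduct.lid ℝ L ∘ₗ LinearMap.rTensor L Complex.imLm

@[simp] lemma rePart_tmul (z : ℂ) (x : L) : rePart L (z ⊗ₜ[ℝ] x) = z.re • x := rfl

@[simp] lemma imPart_tmul (z : ℂ) (x : L) : imPart L (z ⊗ₜ[ℝ] x) = z.im • x := rfl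

lemma one_tmul_rePart_add_I_tmul_imPart (a : ℂ ⊗[ℝ] L) :
    (1 : ℂ) ⊗ₜ[ℝ] rePart L a + Complex.I ⊗ₜ[ℝ] imPart L a = a := by
  induction a using TensorProduct.induction_on with
  | zero => simp
  | add a b ha hb =>
    rw [map_add, map_add, TensorProduct.tmul_add, TensorProduct.tmul_add, add_add_add_comm, ha, hb]
  | tmul z x =>
    rw [rePart_tmul, imPart_tmul, ← TensorProduct.smul_tmul, ← TensorProduct.smul_tmul,
      ← TensorProduct.add_tmul]
    congr 1
    simp [Complex.re_add_im]

lemma one_tmul_injective : Function.Injective fun x : L => (1 : ℂ) ⊗ₜ[ℝ] x := fun x y h => by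
  simpa using congrArg (rePart L) h

lemma rePart_conjugation_complexify (φ : L ≃ₗ⁅ℝ⁆ L) (a : ℂ ⊗[ℝ] L) :
    rePart L (conjugation L (complexify φ a)) = φ (rePart L a) := by
  induction a using TensorProduct.induction_on with
  | zero => simp
  | add a b ha hb => simp only [map_add, ha, hb]
  | tmul z x => simp

lemma imPart_conjugation_complexify (φ : L ≃ₗ⁅ℝ⁆ L) (a : ℂ ⊗[ℝ] L) :
    imPart L (conjugation L (complexify φ a)) = -φ (imPart L a) := by
  induction a using TensorProduct.induction_on with
  | zero => simp
  | add a b ha hb => simp only [map_add, ha, hb, neg_add]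
  | tmul z x => simp

lemma baseChange_ad (Y : L) (a : ℂ ⊗[ℝ] L) :
    (LieAlgebra.ad ℝ L Y).baseChange ℂ a = ⁅(1 : ℂ) ⊗ₜ[ℝ] Y, a⁆ := by
  induction a using TensorProduct.induction_on with
  | zero => rw [map_zero, lie_zero']
  | add a b ha hb => rw [map_add, lie_add', ha, hb]
  | tmul z x => rw [bracket_tmul', one_mul]; rfl

/-! ### The dual as a twisted form of the compact algebra -/

/-- The projection to the fixed points of an involution. -/
def posPart (θ : L ≃ₗ⁅ℝ⁆ L) : L →ₗ[ℝ] L := (2⁻¹ : ℝ) • (LinearMap.id + (θ : L →ₗ[ℝ] L))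

/-- The projection to the `(-1)`-eigenspace of an involution. -/
def negPart (θ : L ≃ₗ⁅ℝ⁆ L) : L →ₗ[ℝ] L := (2⁻¹ : ℝ) • (LinearMap.id - (θ : L →ₗ[ℝ] L))

lemma posPart_apply (θ : L ≃ₗ⁅ℝ⁆ L) (x : L) : posPart θ x = (2⁻¹ : ℝ) • (x + θ x) := rfl

lemma negPart_apply (θ : L ≃ₗ⁅ℝ⁆ L) (x : L) : negPart θ x = (2⁻¹ : ℝ) • (x - θ x) := rfl

variable {θ : L ≃ₗ⁅ℝ⁆ L}

lemma posPart_add_negPart (x : L) : posPart θ x + negPart θ x = x := by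
  rw [posPart_apply, negPart_apply]
  module

lemma posPart_sub_negPart (x : L) : posPart θ x - negPart θ x = θ x := by
  rw [posPart_apply, negPart_apply]
  module

lemma apply_posPart (hθ : IsInvolution θ) (x : L) : θ (posPart θ x) = posPart θ x := by
  rw [posPart_apply, map_smul, map_add, hθ, add_comm]

lemma apply_negPart (hθ : IsInvolution θ) (x : L) : θ (negPart θ x) = -negPart θ x := by
  rw [negPart_apply, map_smul, map_sub, hθ, ← smul_neg, neg_sub]

lemma posPart_of_apply_eq {x : L} (h : θ x = x) : posPart θ x = x := by
  rw [posPart_apply, h]; module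

lemma negPart_of_apply_eq {x : L} (h : θ x = x) : negPart θ x = 0 := by
  rw [negPart_apply, h]; module

lemma posPart_of_apply_eq_neg {x : L} (h : θ x = -x) : posPart θ x = 0 := by
  rw [posPart_apply, h]; module

lemma negPart_of_apply_eq_neg {x : L} (h : θ x = -x) : negPart θ x = x := by
  rw [negPart_apply, h]; module

/-- The linear isomorphism `k + p ↦ k + √-1 p` from the compact algebra to its dual, where
`θ k = k` and `θ p = -p`. -/
def toDual (hθ : IsInvolution θ) : L ≃ₗ[ℝ] dualAlgebra θ where
  toFun x := ⟨(1 : ℂ) ⊗ₜ[ℝ] posPart θ x + Complex.I ⊗ₜ[ℝ] negPart θ x, by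
    rw [mem_dualAlgebra]
    simp [apply_posPart hθ, apply_negPart hθ, TensorProduct.tmul_neg, TensorProduct.neg_tmul]⟩
  map_add' x y := Subtype.ext <| by
    change (1 : ℂ) ⊗ₜ[ℝ] posPart θ (x + y) + Complex.I ⊗ₜ[ℝ] negPart θ (x + y) =
      (_ + _) + (_ + _)
    rw [map_add, map_add, TensorProduct.tmul_add, TensorProduct.tmul_add, add_add_add_comm]
  map_smul' c x := Subtype.ext <| by
    change (1 : ℂ) ⊗ₜ[ℝ] posPart θ (c • x) + Complex.I ⊗ₜ[ℝ] negPart θ (c • x) = c • (_ + _)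
    rw [map_smul, map_smul, TensorProduct.tmul_smul, TensorProduct.tmul_smul, smul_add]
  invFun a := rePart L a + imPart L a
  left_inv x := by simp [posPart_add_negPart]
  right_inv a := Subtype.ext <| by
    have h := mem_dualAlgebra.1 a.2
    have h1 : θ (rePart L a) = rePart L a := by rw [← rePart_conjugation_complexify, h]
    have h2 : θ (imPart L a) = -imPart L a := by
      rw [← neg_eq_iff_eq_neg, ← imPart_conjugation_complexify, h]
    change (1 : ℂ) ⊗ₜ[ℝ] posPart θ _ + Complex.I ⊗ₜ[ℝ] negPart θ _ = (a : ℂ ⊗[ℝ] L)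
    rw [map_add, map_add, posPart_of_apply_eq h1, posPart_of_apply_eq_neg h2,
      negPart_of_apply_eq h1, negPart_of_apply_eq_neg h2, add_zero, zero_add,
      one_tmul_rePart_add_I_tmul_imPart]

lemma coe_toDual (hθ : IsInvolution θ) (x : L) : (toDual hθ x : ℂ ⊗[ℝ] L) =
    (1 : ℂ) ⊗ₜ[ℝ] posPart θ x + Complex.I ⊗ₜ[ℝ] negPart θ x := rfl

lemma coe_toDual_of_apply_eq_neg (hθ : IsInvolution θ) {x : L} (h : θ x = -x) :
    (toDual hθ x : ℂ ⊗[ℝ] L) = Complex.I ⊗ₜ[ℝ] x := by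
  rw [coe_toDual, posPart_of_apply_eq_neg h, negPart_of_apply_eq_neg h, TensorProduct.tmul_zero,
    zero_add]

lemma coe_toDual_of_apply_eq (hθ : IsInvolution θ) {x : L} (h : θ x = x) :
    (toDual hθ x : ℂ ⊗[ℝ] L) = (1 : ℂ) ⊗ₜ[ℝ] x := by
  rw [coe_toDual, posPart_of_apply_eq h, negPart_of_apply_eq h, TensorProduct.tmul_zero,
    add_zero]

lemma dualRestrict_toDual (hθ : IsInvolution θ) (x : L) :
    dualRestrict θ θ hθ (fun _ => rfl) (toDual hθ x) = toDual hθ (θ x) := by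
  refine Subtype.ext ?_
  change complexify θ (_ + _) = _
  rw [coe_toDual, map_add, complexify_tmul, complexify_tmul, apply_posPart hθ, apply_negPart hθ]
  congr 2
  · rw [posPart_apply, posPart_apply, hθ, add_comm]
  · rw [negPart_apply, negPart_apply, hθ, ← smul_neg, neg_sub]

/-- The bracket of the dual, transported to the compact algebra, differs from the original one by
a twist with `θ`. -/
lemma lie_toDual (hθ : IsInvolution θ) (x y : L) :
    ⁅toDual hθ x, toDual hθ y⁆ = toDual hθ (⁅posPart θ x, y⁆ + ⁅negPart θ x, θ y⁆) := by
  have hx := apply_posPart hθ x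
  have hx' := apply_negPart hθ x
  have hy := apply_posPart hθ y
  have hy' := apply_negPart hθ y
  have key : ⁅posPart θ x, y⁆ + ⁅negPart θ x, θ y⁆ =
      (⁅posPart θ x, posPart θ y⁆ - ⁅negPart θ x, negPart θ y⁆) +
      (⁅posPart θ x, negPart θ y⁆ + ⁅negPart θ x, posPart θ y⁆) := by
    conv_lhs => rw [← posPart_sub_negPart (θ := θ) y]
    conv_lhs => enter [1, 2]; rw [← posPart_add_negPart (θ := θ) y]
    rw [lie_add, lie_sub]
    abel
  have h1 : θ (⁅posPart θ x, posPart θ y⁆ - ⁅negPart θ x, negPart θ y⁆) =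
      ⁅posPart θ x, posPart θ y⁆ - ⁅negPart θ x, negPart θ y⁆ := by
    rw [map_sub, LieEquiv.map_lie, LieEquiv.map_lie, hx, hy, hx', hy', neg_lie, lie_neg, neg_neg]
  have h2 : θ (⁅posPart θ x, negPart θ y⁆ + ⁅negPart θ x, posPart θ y⁆) =
      -(⁅posPart θ x, negPart θ y⁆ + ⁅negPart θ x, posPart θ y⁆) := by
    rw [map_add, LieEquiv.map_lie, LieEquiv.map_lie, hx, hy, hx', hy', neg_lie, lie_neg, neg_add]
  refine Subtype.ext ?_
  rw [key, map_add, AddMemClass.coe_add, coe_toDual_of_apply_eq hθ h1,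
    coe_toDual_of_apply_eq_neg hθ h2, LieSubalgebra.coe_bracket, coe_toDual, coe_toDual,
    add_lie, lie_add', lie_add', bracket_tmul', bracket_tmul', bracket_tmul', bracket_tmul',
    Complex.I_mul_I, one_mul, one_mul, mul_one, TensorProduct.neg_tmul, TensorProduct.tmul_sub,
    TensorProduct.tmul_add]
  abel

/-- The involution of the dual is a Cartan involution: for `x = k + p`, the dual Killing form
satisfies `B₀(x, θ x) = B(k, k) + B(p, p)`, since `ad x` acts as `ad k + (ad p) θ`. -/
lemma isCartanInvolution_dualRestrict [FiniteDimensional ℝ L] (hL : IsCompactSemisimple L)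
    (hθ : IsInvolution θ) : IsCartanInvolution (dualRestrict θ θ hθ fun _ => rfl) := by
  refine ⟨fun a => Subtype.ext (complexify_involutive hθ _), fun a ha => ?_⟩
  obtain ⟨x, rfl⟩ := (toDual hθ).surjective a
  rw [dualRestrict_toDual]
  set S : L →ₗ[ℝ] L := (θ : L →ₗ[ℝ] L)
  have hSS : S * S = 1 := LinearMap.ext hθ
  set k := LieAlgebra.ad ℝ L (posPart θ x)
  set p := LieAlgebra.ad ℝ L (negPart θ x)
  have hSp : S * p = -(p * S) := by
    ext y
    change θ ⁅negPart θ x, y⁆ = -⁅negPart θ x, θ y⁆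
    rw [LieEquiv.map_lie, apply_negPart hθ, neg_lie]
  have h1 : LieAlgebra.ad ℝ (dualAlgebra θ) (toDual hθ x) = (toDual hθ).conj (k + p * S) := by
    ext1 a
    obtain ⟨y, rfl⟩ := (toDual hθ).surjective a
    rw [LinearEquiv.conj_apply_apply, LinearEquiv.symm_apply_apply]
    exact lie_toDual hθ x y
  have h2 : LieAlgebra.ad ℝ (dualAlgebra θ) (toDual hθ (θ x)) = (toDual hθ).conj (k - p * S) := by
    ext1 a
    obtain ⟨y, rfl⟩ := (toDual hθ).surjective a
    rw [LinearEquiv.conj_apply_apply, LinearEquiv.symm_apply_apply]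
    refine (lie_toDual hθ _ y).trans (congrArg _ ?_)
    have e1 : posPart θ (θ x) = posPart θ x := by
      rw [posPart_apply, posPart_apply, hθ, add_comm]
    have e2 : negPart θ (θ x) = -negPart θ x := by
      rw [negPart_apply, negPart_apply, hθ, ← smul_neg, neg_sub]
    rw [e1, e2, neg_lie, ← sub_eq_add_neg]
    rfl
  have h3 : killingForm ℝ (dualAlgebra θ) (toDual hθ x) (toDual hθ (θ x)) =
      killingForm ℝ L (posPart θ x) (posPart θ x) +
        killingForm ℝ L (negPart θ x) (negPart θ x) := by
    rw [killingForm_apply_apply, h1, h2, ← LinearEquiv.conj_comp, LinearMap.trace_conj',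
      killingForm_apply_apply, killingForm_apply_apply, ← Module.End.mul_eq_comp,
      ← Module.End.mul_eq_comp, ← Module.End.mul_eq_comp]
    have e : (k + p * S) * (k - p * S) = k * k + p * p + ((p * S) * k - k * (p * S)) := by
      have : (p * S) * (p * S) = -(p * p) := by
        rw [mul_assoc, ← mul_assoc S, hSp, neg_mul, mul_assoc, hSS, mul_one, mul_neg]
      rw [add_mul, mul_sub, mul_sub, this]
      abel
    rw [e, map_add, map_add, map_sub, LinearMap.trace_mul_comm ℝ (p * S) k, sub_self, add_zero]
  have hle (y : L) : killingForm ℝ L y y ≤ 0 := by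
    rcases eq_or_ne y 0 with rfl | hy
    · simp
    · exact (hL.2 y hy).le
  have hx : x ≠ 0 := by rintro rfl; exact ha (map_zero _)
  rw [h3]
  by_cases hk : posPart θ x = 0
  · have hp : negPart θ x ≠ 0 := fun hp => hx <| by
      rw [← posPart_add_negPart (θ := θ) x, hk, hp, add_zero]
    linarith [hle (posPart θ x), hL.2 _ hp]
  · linarith [hle (negPart θ x), hL.2 _ hk]

end Dual

section Dual

variable {L : Type*} [LieRing L] [LieAlgebra ℝ L] {θ : L ≃ₗ⁅ℝ⁆ L}

attribute [local instance] LieRing.toBracket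

lemma smul_lie' (z : ℂ) (a b : ℂ ⊗[ℝ] L) : ⁅z • a, b⁆ = z • ⁅a, b⁆ := smul_lie z a b

lemma lie_smul' (z : ℂ) (a b : ℂ ⊗[ℝ] L) : ⁅a, z • b⁆ = z • ⁅a, b⁆ := lie_smul z a b

/-! ### Inner automorphisms diagonalized by the dual -/

lemma linearMap_ext_of_iSup_eq_top {M N ι : Type*} [AddCommGroup M] [Module ℝ M] [AddCommGroup N]
    [Module ℝ N] {V : ι → Submodule ℝ M} (hV : ⨆ i, V i = ⊤) {f g : M →ₗ[ℝ] N}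
    (h : ∀ i, ∀ y ∈ V i, f y = g y) : f = g := by
  have hle : (⊤ : Submodule ℝ M) ≤ LinearMap.eqLocus f g := by
    rw [← hV]
    exact iSup_le fun i y hy => h i y hy
  exact LinearMap.ext fun y => hle (x := y) trivial

/-- A complex linear map on the complexification is determined by its values on subspaces spanning
the real form `𝔤₀`. -/
lemma complex_linearMap_ext_of_iSup_eq_top (hθ : IsInvolution θ) {W ι : Type*} [AddCommGroup W]
    [Module ℂ W] {V : ι → Submodule ℝ (dualAlgebra θ)} (hV : ⨆ i, V i = ⊤)
    {f g : (ℂ ⊗[ℝ] L) →ₗ[ℂ] W} (h : ∀ i, ∀ y ∈ V i, f y = g y) : f = g := by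
  -- Restriction of scalars, so that the two maps can be compared on the real form.
  let _ : Module ℝ W := Module.compHom W Complex.ofRealHom
  have _ : IsScalarTower ℝ ℂ W := ⟨fun a b w => by
    rw [Complex.real_smul, mul_smul]; rfl⟩
  have hd : f.restrictScalars ℝ ∘ₗ (dualAlgebra θ).toSubmodule.subtype =
      g.restrictScalars ℝ ∘ₗ (dualAlgebra θ).toSubmodule.subtype :=
    linearMap_ext_of_iSup_eq_top hV h
  have hd' (y : dualAlgebra θ) : f y = g y := LinearMap.congr_fun hd y
  have h1 (x : L) : f ((1 : ℂ) ⊗ₜ[ℝ] x) = g ((1 : ℂ) ⊗ₜ[ℝ] x) := by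
    have e : (1 : ℂ) ⊗ₜ[ℝ] x = (toDual hθ (posPart θ x) : ℂ ⊗[ℝ] L) +
        (-Complex.I) • (toDual hθ (negPart θ x) : ℂ ⊗[ℝ] L) := by
      rw [coe_toDual_of_apply_eq hθ (apply_posPart hθ x),
        coe_toDual_of_apply_eq_neg hθ (apply_negPart hθ x), TensorProduct.smul_tmul', smul_eq_mul,
        neg_mul, Complex.I_mul_I, neg_neg, ← TensorProduct.tmul_add, posPart_add_negPart]
    rw [e, map_add, map_add, map_smul, map_smul, hd', hd']
  ext x
  exact h1 x

/-- The adjoint action of `p` on the complexification acts by the scalar `c i` on the subspace `V i`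
of the real form `𝔤₀`, and these subspaces span `𝔤₀`. -/
structure IsDiagonalizedBy {ι : Type*} (p : L) (V : ι → Submodule ℝ (dualAlgebra θ))
    (c : ι → ℂ) : Prop where
  iSup_eq_top : ⨆ i, V i = ⊤
  lie_eq : ∀ i, ∀ y ∈ V i, ⁅(1 : ℂ) ⊗ₜ[ℝ] p, (y : ℂ ⊗[ℝ] L)⁆ = c i • (y : ℂ ⊗[ℝ] L)

lemma IsDiagonalizedBy.neg {ι : Type*} {p : L} {V : ι → Submodule ℝ (dualAlgebra θ)} {c : ι → ℂ}
    (h : IsDiagonalizedBy p V c) : IsDiagonalizedBy (-p) V (-c) where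
  iSup_eq_top := h.iSup_eq_top
  lie_eq i y hy := by
    rw [TensorProduct.tmul_neg, neg_lie, h.lie_eq i y hy, Pi.neg_apply, neg_smul]

lemma coe_toDual_smul (hθ : IsInvolution θ) {p : L} (hp : θ p = -p) :
    (toDual hθ ((-(2 / Real.pi)) • p) : ℂ ⊗[ℝ] L) =
      (2 / ((Real.pi : ℂ) * Complex.I)) • (1 : ℂ) ⊗ₜ[ℝ] p := by
  rw [coe_toDual_of_apply_eq_neg hθ (by rw [map_smul, hp, smul_neg]), ← TensorProduct.smul_tmul,
    TensorProduct.smul_tmul']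
  congr 1
  rw [Complex.real_smul, smul_eq_mul, mul_one]
  have : (Real.pi : ℂ) ≠ 0 := Complex.ofReal_ne_zero.2 Real.pi_ne_zero
  push_cast
  field_simp
  rw [Complex.I_sq]
  ring

lemma lie_one_tmul_of_lie_toDual (hθ : IsInvolution θ) {p : L} (hp : θ p = -p)
    {y : dualAlgebra θ} {c : ℝ} (h : ⁅toDual hθ p, y⁆ = c • y) :
    ⁅(1 : ℂ) ⊗ₜ[ℝ] p, (y : ℂ ⊗[ℝ] L)⁆ = (-Complex.I * c) • (y : ℂ ⊗[ℝ] L) := by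
  have h1 : Complex.I • ⁅(1 : ℂ) ⊗ₜ[ℝ] p, (y : ℂ ⊗[ℝ] L)⁆ = (c : ℂ) • (y : ℂ ⊗[ℝ] L) := by
    rw [← smul_lie', TensorProduct.smul_tmul', smul_eq_mul, mul_one,
      ← coe_toDual_of_apply_eq_neg hθ hp, ← LieSubalgebra.coe_bracket, h]
    exact (algebraMap_smul ℂ c (y : ℂ ⊗[ℝ] L)).symm
  rw [mul_smul, ← h1, smul_smul, neg_mul, Complex.I_mul_I, neg_neg, one_smul]

/-- The complexified eigenvalues of `ad p` on the grading of `𝔤₀` with characteristic element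
`2 p / (π √-1)`. -/
lemma isDiagonalizedBy_of_isAssociatedPair (hθ : IsInvolution θ) {p : L} (hp : θ p = -p)
    {V : ℤ → Submodule ℝ (dualAlgebra θ)} (htop : ⨆ k, V k = ⊤)
    {τ : dualAlgebra θ ≃ₗ⁅ℝ⁆ dualAlgebra θ}
    (hV : IsAssociatedPair V (toDual hθ ((-(2 / Real.pi)) • p)) τ) :
    IsDiagonalizedBy p V fun k => Real.pi * Complex.I / 2 * k := by
  refine ⟨htop, fun k y hy => ?_⟩
  have h := (hV.mem_iff k y).1 hy
  have h1 : ⁅toDual hθ p, y⁆ = (-(Real.pi / 2) * k) • y := by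
    rw [map_smul, smul_lie] at h
    rw [mul_smul, ← h, smul_smul]
    have : -(Real.pi / 2) * -(2 / Real.pi) = 1 := by
      have := Real.pi_ne_zero
      field_simp
    rw [this, one_smul]
  rw [lie_one_tmul_of_lie_toDual hθ hp h1]
  congr 1
  push_cast
  ring

lemma exp_pi_mul_I_mul_int (k : ℤ) :
    Complex.exp (Real.pi * Complex.I * k) = (((-1 : ℝ) ^ k : ℝ) : ℂ) := by
  rw [mul_comm, Complex.exp_int_mul, Complex.exp_pi_mul_I]
  push_cast
  rfl

lemma exp_neg_pi_mul_I_mul_int (k : ℤ) :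
    Complex.exp (-(Real.pi * Complex.I * k)) = (((-1 : ℝ) ^ k : ℝ) : ℂ) := by
  rw [show -(Real.pi * Complex.I * k : ℂ) = Real.pi * Complex.I * ((-k : ℤ) : ℂ) by push_cast; ring,
    exp_pi_mul_I_mul_int]
  congr 1
  rw [zpow_neg, ← inv_zpow]
  norm_num

variable [FiniteDimensional ℝ L]

lemma baseChange_expAd_apply {Y : L} {c : ℂ} {a : ℂ ⊗[ℝ] L}
    (h : ⁅(1 : ℂ) ⊗ₜ[ℝ] Y, a⁆ = c • a) :
    (expAd Y).baseChange ℂ a = Complex.exp c • a :=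
  baseChange_expEnd_apply_of_apply_eq _ ((baseChange_ad Y a).trans h)

namespace IsDiagonalizedBy

variable {ι : Type*} {p : L} {V : ι → Submodule ℝ (dualAlgebra θ)} {c : ι → ℂ}

lemma expAd_neg_expAd (h : IsDiagonalizedBy p V c) (hθ : IsInvolution θ) (x : L) :
    expAd (-p) (expAd p x) = x := by
  have key : (expAd (-p)).baseChange ℂ ∘ₗ (expAd p).baseChange ℂ = LinearMap.id := by
    refine complex_linearMap_ext_of_iSup_eq_top hθ h.iSup_eq_top fun i y hy => ?_
    rw [LinearMap.comp_apply, baseChange_expAd_apply (h.lie_eq i y hy), map_smul,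
      baseChange_expAd_apply (h.neg.lie_eq i y hy), smul_smul, ← Complex.exp_add, Pi.neg_apply,
      add_neg_cancel, Complex.exp_zero, one_smul, LinearMap.id_apply]
  exact one_tmul_injective (LinearMap.congr_fun key ((1 : ℂ) ⊗ₜ[ℝ] x))

lemma expAd_lie (h : IsDiagonalizedBy p V c) (hθ : IsInvolution θ) (x y : L) :
    expAd p ⁅x, y⁆ = ⁅expAd p x, expAd p y⁆ := by
  set E := (expAd p).baseChange ℂ
  let ad : (ℂ ⊗[ℝ] L) →ₗ[ℂ] (ℂ ⊗[ℝ] L) →ₗ[ℂ] (ℂ ⊗[ℝ] L) :=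
    LinearMap.mk₂ ℂ (fun a b => ⁅a, b⁆) (fun a b c => add_lie a b c) smul_lie' lie_add'
      fun z a b => lie_smul' z a b
  have key : ad.compr₂ E = ad.compl₁₂ E E := by
    refine complex_linearMap_ext_of_iSup_eq_top hθ h.iSup_eq_top fun i x hx => ?_
    refine complex_linearMap_ext_of_iSup_eq_top hθ h.iSup_eq_top fun j y hy => ?_
    change E ⁅(x : ℂ ⊗[ℝ] L), (y : ℂ ⊗[ℝ] L)⁆ = ⁅E x, E y⁆
    have hxy : ⁅(1 : ℂ) ⊗ₜ[ℝ] p, ⁅(x : ℂ ⊗[ℝ] L), (y : ℂ ⊗[ℝ] L)⁆⁆ =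
        (c i + c j) • ⁅(x : ℂ ⊗[ℝ] L), (y : ℂ ⊗[ℝ] L)⁆ := by
      rw [leibniz_lie, h.lie_eq i x hx, h.lie_eq j y hy, smul_lie', lie_smul', add_smul]
    rw [baseChange_expAd_apply hxy, baseChange_expAd_apply (h.lie_eq i x hx),
      baseChange_expAd_apply (h.lie_eq j y hy), smul_lie', lie_smul', smul_smul, Complex.exp_add]
  have h1 := LinearMap.congr_fun₂ key ((1 : ℂ) ⊗ₜ[ℝ] x) ((1 : ℂ) ⊗ₜ[ℝ] y)
  change E ⁅(1 : ℂ) ⊗ₜ[ℝ] x, (1 : ℂ) ⊗ₜ[ℝ] y⁆ = ⁅(1 : ℂ) ⊗ₜ[ℝ] expAd p x, (1 : ℂ) ⊗ₜ[ℝ] expAd p y⁆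
    at h1
  rw [bracket_tmul', bracket_tmul', one_mul] at h1
  exact one_tmul_injective h1

/-- The automorphism `e^{ad p}`. -/
def expAdEquiv (h : IsDiagonalizedBy p V c) (hθ : IsInvolution θ) : L ≃ₗ⁅ℝ⁆ L where
  toFun := expAd p
  map_add' := map_add _
  map_smul' := map_smul _
  map_lie' {x y} := h.expAd_lie hθ x y
  invFun := expAd (-p)
  left_inv := h.expAd_neg_expAd hθ
  right_inv x := by simpa using h.neg.expAd_neg_expAd hθ x

/-- The automorphism `e^{ad p} θ e^{-ad p}`. -/
def conjEquiv (h : IsDiagonalizedBy p V c) (hθ : IsInvolution θ) : L ≃ₗ⁅ℝ⁆ L :=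
  (h.expAdEquiv hθ).symm.trans (θ.trans (h.expAdEquiv hθ))

lemma conjEquiv_apply (h : IsDiagonalizedBy p V c) (hθ : IsInvolution θ) (x : L) :
    h.conjEquiv hθ x = expAd p (θ (expAd (-p) x)) := rfl

lemma isInvolution_conjEquiv (h : IsDiagonalizedBy p V c) (hθ : IsInvolution θ) :
    IsInvolution (h.conjEquiv hθ) := fun x => by
  have h1 := h.neg.expAd_neg_expAd hθ
  rw [neg_neg] at h1
  rw [conjEquiv_apply, conjEquiv_apply, h.expAd_neg_expAd hθ, hθ, h1]

/-- On an eigenvector `y` with eigenvalue `c i` of `ad p`, where `θ p = -p`, both `θ y` and `y` are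
eigenvectors with opposite eigenvalues, so `e^{ad p} θ e^{-ad p}` acts as `e^{-2 c i} θ`. -/
lemma complexify_conjEquiv (h : IsDiagonalizedBy p V c) (hθ : IsInvolution θ) (hp : θ p = -p)
    {i : ι} {y : dualAlgebra θ} (hy : y ∈ V i) :
    complexify (h.conjEquiv hθ) y = Complex.exp (-(2 * c i)) • complexify θ y := by
  have h1 : complexify (h.conjEquiv hθ) =
      (expAd p).baseChange ℂ ∘ₗ complexify θ ∘ₗ (expAd (-p)).baseChange ℂ := by
    ext x
    rfl
  have h2 : ⁅(1 : ℂ) ⊗ₜ[ℝ] p, complexify θ (y : ℂ ⊗[ℝ] L)⁆ =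
      (-c i) • complexify θ (y : ℂ ⊗[ℝ] L) := by
    have := congrArg (complexify θ) (h.lie_eq i y hy)
    rw [complexify_lie, complexify_tmul, hp, TensorProduct.tmul_neg, neg_lie, map_smul] at this
    rw [neg_smul, ← this, neg_neg]
  rw [h1, LinearMap.comp_apply, LinearMap.comp_apply,
    baseChange_expAd_apply (h.neg.lie_eq i y hy), map_smul, map_smul, baseChange_expAd_apply h2,
    smul_smul, ← Complex.exp_add, Pi.neg_apply]
  congr 2
  ring

end IsDiagonalizedBy

/-! ### The operator `σ_Z` on a grading -/

/-- `σ_Z` acts by `(-1)^k` in degree `k` of the grading defined by `Z`. -/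
lemma eqSigmaZComp_of_iSup_eq_top {V : ℤ → Submodule ℝ L} {Z : L} {σ : L ≃ₗ⁅ℝ⁆ L}
    (hθ : IsInvolution θ) (htop : ⨆ k, V k = ⊤)
    (hV : ∀ k, ∀ y ∈ V k, ⁅Z, y⁆ = (k : ℝ) • y)
    (hσ : ∀ k, ∀ y ∈ V k, σ (θ y) = ((-1 : ℝ) ^ k) • y) : EqSigmaZComp σ Z θ := by
  have key : (TensorProduct.mk ℝ ℂ L 1) ∘ₗ (σ : L →ₗ[ℝ] L) ∘ₗ (θ : L →ₗ[ℝ] L) =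
      (sigmaZ Z).restrictScalars ℝ ∘ₗ TensorProduct.mk ℝ ℂ L 1 := by
    refine linearMap_ext_of_iSup_eq_top htop fun k y hy => ?_
    change (1 : ℂ) ⊗ₜ[ℝ] σ (θ y) = sigmaZ Z ((1 : ℂ) ⊗ₜ[ℝ] y)
    have h : (((Real.pi : ℂ) * Complex.I) • LieAlgebra.ad ℂ (ℂ ⊗[ℝ] L) ((1 : ℂ) ⊗ₜ[ℝ] Z))
        ((1 : ℂ) ⊗ₜ[ℝ] y) = (Real.pi * Complex.I * k : ℂ) • (1 : ℂ) ⊗ₜ[ℝ] y := by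
      rw [LinearMap.smul_apply, LieAlgebra.ad_apply, bracket_tmul', hV k y hy, mul_one,
        TensorProduct.tmul_smul, mul_smul _ (k : ℂ), ← algebraMap_smul ℂ (k : ℝ)]
      simp
    rw [sigmaZ, expEnd_apply_of_apply_eq _ h, exp_pi_mul_I_mul_int, hσ k y hy,
      TensorProduct.tmul_smul, ← algebraMap_smul ℂ]
    rfl
  intro x
  have := LinearMap.congr_fun key (θ x)
  change (1 : ℂ) ⊗ₜ[ℝ] σ (θ (θ x)) = _ at this
  rw [hθ] at this
  exact this

end Dual

section Main

variable {L : Type*} [LieRing L] [LieAlgebra ℝ L] {θ : L ≃ₗ⁅ℝ⁆ L}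

attribute [local instance] LieRing.toBracket

/-! ### Maximal abelian subspaces and restricted roots -/

lemma lie_toDual_of_apply_eq_neg (hθ : IsInvolution θ) {p q : L} (hp : θ p = -p) (hq : θ q = -q) :
    ⁅toDual hθ p, toDual hθ q⁆ = -toDual hθ ⁅p, q⁆ := by
  rw [lie_toDual, posPart_of_apply_eq_neg hp, negPart_of_apply_eq_neg hp, zero_lie, zero_add, hq,
    lie_neg, map_neg]

lemma IsMaximalAbelianIn.mem_of_lie_eq_zero {𝔭 𝔞 : Submodule ℝ L} (h : IsMaximalAbelianIn 𝔭 𝔞)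
    {x : L} (hx : x ∈ 𝔭) (hcomm : ∀ a ∈ 𝔞, ⁅a, x⁆ = 0) : x ∈ 𝔞 := by
  have hprop : 𝔞 ⊔ Submodule.span ℝ {x} ≤ 𝔭 ∧
      ∀ u ∈ 𝔞 ⊔ Submodule.span ℝ {x}, ∀ v ∈ 𝔞 ⊔ Submodule.span ℝ {x}, ⁅u, v⁆ = 0 := by
    refine ⟨sup_le h.prop.1 ((Submodule.span_singleton_le_iff_mem _ _).2 hx), ?_⟩
    intro u hu v hv
    obtain ⟨a, ha, u', hu', rfl⟩ := Submodule.mem_sup.1 hu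
    obtain ⟨b, hb, v', hv', rfl⟩ := Submodule.mem_sup.1 hv
    obtain ⟨s, rfl⟩ := Submodule.mem_span_singleton.1 hu'
    obtain ⟨t, rfl⟩ := Submodule.mem_span_singleton.1 hv'
    have hxb : ⁅x, b⁆ = 0 := by rw [← lie_skew, hcomm b hb, neg_zero]
    simp [h.prop.2 a ha b hb, hcomm a ha, hxb]
  exact h.le_of_ge hprop le_sup_left
    (Submodule.mem_sup_right (Submodule.mem_span_singleton_self x))

/-- A weight `χ` of `𝔞` on `𝔤₀` is `-⟨λ, ·⟩` for some `λ` which is zero or a restricted root, as the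
weight vectors in `𝔤₀ ⊆ 𝔤_ℂ` are root vectors. Hence it takes values in `(π/2) ℤ` on `Γ`. -/
lemma exists_int_of_mem_latticeΓ [FiniteDimensional ℝ L] (hθ : IsInvolution θ)
    {B : LinearMap.BilinForm ℝ L} (hB : IsInvariantInner B) {𝔞 : Submodule ℝ L}
    (hneg : ∀ a ∈ 𝔞, θ a = -a) {Z₁ : L} (hZ₁ : Z₁ ∈ latticeΓ B 𝔞) {y : dualAlgebra θ} (hy0 : y ≠ 0)
    {χ : 𝔞 → ℝ} (hχ : ∀ a : 𝔞, ⁅toDual hθ (a : L), y⁆ = χ a • y) :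
    ∃ n : ℤ, χ ⟨Z₁, hZ₁.1⟩ = Real.pi / 2 * n := by
  have hinj : Function.Injective fun c : ℝ => c • y := smul_left_injective ℝ hy0
  let f : Module.Dual ℝ 𝔞 :=
    { toFun := fun a => -χ a
      map_add' := fun a b => by
        have : χ (a + b) = χ a + χ b := hinj <| by
          change χ (a + b) • y = (χ a + χ b) • y
          rw [← hχ, Submodule.coe_add, map_add, add_lie, hχ, hχ, add_smul]
        rw [this, neg_add]
      map_smul' := fun t a => by
        have : χ (t • a) = t * χ a := hinj <| by
          change χ (t • a) • y = (t * χ a) • y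
          rw [← hχ, Submodule.coe_smul, map_smul, smul_lie, hχ, mul_smul]
        rw [this, RingHom.id_apply, smul_eq_mul, mul_neg] }
  have hnd : (B.restrict 𝔞).Nondegenerate := by
    have hsymm : (B.restrict 𝔞).IsSymm := ⟨fun a b => hB.symm a b⟩
    refine hsymm.isRefl.nondegenerate_iff_separatingLeft.2 ?_
    intro a ha
    by_contra h
    exact (hB.pos (a : L) (by simpa using h)).ne' (ha a)
  obtain ⟨l, hl⟩ : ∃ l : 𝔞, ∀ a : 𝔞, B l a = -χ a :=
    ⟨((B.restrict 𝔞).toDual hnd).symm f, fun a => by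
      exact LinearMap.BilinForm.apply_toDual_symm_apply (hB := hnd) f a⟩
  rcases eq_or_ne (l : L) 0 with h0 | h0
  · refine ⟨0, ?_⟩
    have := hl ⟨Z₁, hZ₁.1⟩
    rw [h0, map_zero, LinearMap.zero_apply] at this
    rw [Int.cast_zero, mul_zero]
    linarith
  · have hroot : (l : L) ∈ restrictedRoots B 𝔞 := by
      refine ⟨l.2, h0, y, fun h => hy0 (Subtype.ext h), fun A hA => ?_⟩
      refine (lie_one_tmul_of_lie_toDual hθ (hneg A hA) (hχ ⟨A, hA⟩)).trans ?_
      rw [hl ⟨A, hA⟩]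
      congr 1
      push_cast
      ring
    obtain ⟨n, hn⟩ := hZ₁.2 _ hroot
    refine ⟨-n, ?_⟩
    have := hl ⟨Z₁, hZ₁.1⟩
    rw [hn] at this
    push_cast
    linarith

end Main

end SymTriad

end

theorem mainTheorem3 {𝔤 : Type*} [LieRing 𝔤] [LieAlgebra ℝ 𝔤] [FiniteDimensional ℝ 𝔤]
    (hcompact : SymTriad.IsCompactSemisimple 𝔤)
    (θ₁ : 𝔤 ≃ₗ⁅ℝ⁆ 𝔤) (hθ₁ : SymTriad.IsInvolution θ₁) (hne : θ₁ ≠ LieEquiv.refl)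
    (B : LinearMap.BilinForm ℝ 𝔤) (hB : SymTriad.IsInvariantInner B)
    (𝔞₁ : Submodule ℝ 𝔤) (h𝔞₁ : SymTriad.IsMaximalAbelianIn (SymTriad.negEigenspace θ₁) 𝔞₁)
    (Z₁ : 𝔤) (hZ₁ : Z₁ ∈ SymTriad.latticeΓ B 𝔞₁) :
    ∃ T : SymTriad.CommTriad 𝔤,
      T.θ₁ = θ₁ ∧
      (∀ x, T.θ₂ x = SymTriad.expAd Z₁ (θ₁ (SymTriad.expAd (-Z₁) x))) ∧
      SymTriad.IsTypeKEps T.dual T.dualσ ∧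
      ∃ Z : T.dual,
        (Z : TensorProduct ℝ ℂ 𝔤) =
          (2 / ((Real.pi : ℂ) * Complex.I)) • TensorProduct.tmul ℝ (1 : ℂ) Z₁ ∧
        ∃ (m : ℕ) (V : ℤ → Submodule ℝ T.dual),
          (Z₁ ≠ 0 → 0 < m) ∧
          SymTriad.IsGradingOfKind m V ∧
          SymTriad.IsAssociatedPair V Z T.dualθ ∧
          SymTriad.EqSigmaZComp T.dualσ Z T.dualθ := by
  open SymTriad in
  have hneg : ∀ a ∈ 𝔞₁, θ₁ a = -a := fun a ha => h𝔞₁.prop.1 ha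
  have hZ₁neg := hneg Z₁ hZ₁.1
  have hθ := isCartanInvolution_dualRestrict hcompact hθ₁
  set τ := dualRestrict θ₁ θ₁ hθ₁ fun _ => rfl
  have hτneg {p : 𝔤} (hp : θ₁ p = -p) : τ (toDual hθ₁ p) = -toDual hθ₁ p := by
    rw [dualRestrict_toDual, hp, map_neg]
  obtain ⟨x₀, hx₀, hx₀0⟩ : ∃ x, θ₁ x = -x ∧ x ≠ 0 := by
    by_contra! hcon
    refine hne (LieEquiv.ext fun x => ?_)
    have := hcon (x - θ₁ x) (by rw [map_sub, hθ₁, neg_sub])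
    exact (sub_eq_zero.1 this).symm
  have hnontriv : Nontrivial (dualAlgebra θ₁) :=
    ⟨toDual hθ₁ x₀, 0, (toDual hθ₁).map_ne_zero_iff.2 hx₀0⟩
  -- The maximal abelian subspace `√-1 𝔞₁` of the `(-1)`-eigenspace in `𝔤₀`.
  let 𝔞₀ : Submodule ℝ (dualAlgebra θ₁) := 𝔞₁.map (toDual hθ₁).toLinearMap
  have h𝔞₀neg : ∀ a ∈ 𝔞₀, τ a = -a := by
    rintro _ ⟨a, ha, rfl⟩
    exact hτneg (hneg a ha)
  have h𝔞₀abel : ∀ a ∈ 𝔞₀, ∀ b ∈ 𝔞₀, ⁅a, b⁆ = 0 := by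
    rintro _ ⟨a, ha, rfl⟩ _ ⟨b, hb, rfl⟩
    refine (lie_toDual_of_apply_eq_neg hθ₁ (hneg a ha) (hneg b hb)).trans ?_
    rw [h𝔞₁.prop.2 a ha b hb, map_zero, neg_zero]
  have h𝔞₀max : ∀ x, τ x = -x → (∀ a ∈ 𝔞₀, ⁅a, x⁆ = 0) → x ∈ 𝔞₀ := by
    intro x hx hcomm
    obtain ⟨x, rfl⟩ := (toDual hθ₁).surjective x
    have hx' : θ₁ x = -x := (toDual hθ₁).injective <| by
      rw [map_neg, ← hx, dualRestrict_toDual]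
    refine ⟨x, h𝔞₁.mem_of_lie_eq_zero hx' fun a ha => ?_, rfl⟩
    have := hcomm _ ⟨a, ha, rfl⟩
    have h2 := (lie_toDual_of_apply_eq_neg hθ₁ (hneg a ha) hx').symm.trans this
    rw [neg_eq_zero] at h2
    exact (toDual hθ₁).map_eq_zero_iff.1 h2
  have h𝔞₀ne : 𝔞₀ ≠ ⊥ := by
    intro hbot
    have := h𝔞₀max _ (hτneg hx₀) fun a ha => by
      rw [hbot, Submodule.mem_bot] at ha
      rw [ha, zero_lie]
    rw [hbot, Submodule.mem_bot] at this
    exact hx₀0 ((toDual hθ₁).map_eq_zero_iff.1 this)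
  have hscale {p : 𝔤} (hp : p ∈ 𝔞₁) : toDual hθ₁ ((-(2 / Real.pi)) • p) ∈ 𝔞₀ :=
    ⟨_, 𝔞₁.smul_mem _ hp, rfl⟩
  set Z := toDual hθ₁ ((-(2 / Real.pi)) • Z₁)
  have hZmem : Z ∈ 𝔞₀ := hscale hZ₁.1
  -- The condition `Z₁ ∈ Γ` says that `Z` takes integral values at the weights of `𝔞₀`.
  have hZtop := hθ.iSup_eigenspace_int_eq_top h𝔞₀neg h𝔞₀abel hZmem fun χ y hy0 hχ => by
    obtain ⟨n, hn⟩ := exists_int_of_mem_latticeΓ hθ₁ hB hneg hZ₁ hy0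
      (χ := fun a => χ ⟨toDual hθ₁ a, a, a.2, rfl⟩) fun a => hχ ⟨toDual hθ₁ a, a, a.2, rfl⟩
    refine ⟨-n, smul_left_injective ℝ hy0 ?_⟩
    change χ ⟨Z, hZmem⟩ • y = ((-n : ℤ) : ℝ) • y
    rw [← hχ ⟨Z, hZmem⟩]
    change ⁅toDual hθ₁ ((-(2 / Real.pi)) • Z₁), y⁆ = _
    rw [map_smul, smul_lie, hχ ⟨toDual hθ₁ Z₁, Z₁, hZ₁.1, rfl⟩, hn, smul_smul]
    congr 1
    have := Real.pi_ne_zero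
    push_cast
    field_simp
  obtain ⟨m, V, hm, hgrad, hpair⟩ := hθ.exists_grading (h𝔞₀neg Z hZmem) hZtop
  have hVtop : ⨆ k, V k = ⊤ := hgrad.internal.submodule_iSup_eq_top
  have hdiag := isDiagonalizedBy_of_isAssociatedPair hθ₁ hZ₁neg hVtop hpair
  set θ₂ := hdiag.conjEquiv hθ₁
  -- On the part of degree `k`, the involution `θ₂` is `(-1)^k θ₁`.
  have hθ₂ {k : ℤ} {y : dualAlgebra θ₁} (hy : y ∈ V k) : complexify θ₂ y =
      (((-1 : ℝ) ^ k : ℝ) : ℂ) • complexify θ₁ y := by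
    rw [hdiag.complexify_conjEquiv hθ₁ hZ₁neg hy, ← exp_neg_pi_mul_I_mul_int]
    congr 3
    ring
  have hτV {k : ℤ} {y : dualAlgebra θ₁} (hy : y ∈ V k) : τ y ∈ V (-k) := by
    rw [hpair.mem_iff] at hy ⊢
    rw [lie_apply_eq_neg_smul_of_lie_eq_smul hpair.reversing hy, Int.cast_neg]
  have hθ₂τ {k : ℤ} {y : dualAlgebra θ₁} (hy : y ∈ V k) :
      complexify θ₂ (complexify θ₁ y) = (((-1 : ℝ) ^ k : ℝ) : ℂ) • (y : TensorProduct ℝ ℂ 𝔤) := by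
    have h := hθ₂ (hτV hy)
    change complexify θ₂ (complexify θ₁ y) = _ • complexify θ₁ (complexify θ₁ y) at h
    rw [h, complexify_involutive hθ₁, zpow_neg, ← inv_zpow]
    norm_num
  have hcomm : ∀ x, θ₁ (θ₂ x) = θ₂ (θ₁ x) := by
    have key : complexify θ₁ ∘ₗ complexify θ₂ = complexify θ₂ ∘ₗ complexify θ₁ := by
      refine complex_linearMap_ext_of_iSup_eq_top hθ₁ hVtop fun k y hy => ?_
      rw [LinearMap.comp_apply, LinearMap.comp_apply, hθ₂ hy, hθ₂τ hy, map_smul,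
        complexify_involutive hθ₁]
    intro x
    exact one_tmul_injective (LinearMap.congr_fun key (TensorProduct.tmul ℝ (1 : ℂ) x))
  let T : CommTriad 𝔤 := ⟨hcompact, θ₁, θ₂, hθ₁, hdiag.isInvolution_conjEquiv hθ₁, hcomm⟩
  have hσV (k : ℤ) (y : dualAlgebra θ₁) (hy : y ∈ V k) :
      T.dualσ (τ y) = ((-1 : ℝ) ^ k) • y := by
    refine Subtype.ext ((hθ₂τ hy).trans ?_)
    exact algebraMap_smul ℂ ((-1 : ℝ) ^ k) (y : TensorProduct ℝ ℂ 𝔤)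
  have hσ : EqSigmaZComp T.dualσ Z τ :=
    eqSigmaZComp_of_iSup_eq_top hθ.1 hVtop (fun k y hy => (hpair.mem_iff k y).1 hy) hσV
  have hσinv : IsInvolution T.dualσ := fun a => Subtype.ext (complexify_involutive T.inv₂ _)
  refine ⟨T, rfl, fun x => rfl, ⟨?_, hσinv, ?_⟩, Z, coe_toDual_smul hθ₁ hZ₁neg, m, V, fun h => ?_,
    hgrad, hpair, hσ⟩
  · exact hθ.isNoncompactSemisimple ((toDual hθ₁).map_ne_zero_iff.2 hx₀0) (hτneg hx₀)
  · by_cases hZ0 : Z₁ = 0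
    · -- Here `σ = θ`, and twice a restricted coroot defines a grading with only even degrees.
      obtain ⟨h, hh, hh0, hint⟩ := hθ.exists_integral h𝔞₀neg h𝔞₀abel h𝔞₀max h𝔞₀ne
      have heven {c : ℝ} {y : dualAlgebra θ₁} (hy0 : y ≠ 0) (hy : ⁅(2 : ℝ) • h, y⁆ = c • y) :
          ∃ n : ℤ, c = (2 * n : ℤ) := by
        obtain ⟨n, hn⟩ := hint (c / 2) y hy0 <| by
          rw [smul_lie] at hy
          rw [div_eq_inv_mul, mul_smul, ← hy, smul_smul, inv_mul_cancel₀ two_ne_zero, one_smul]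
        exact ⟨n, by push_cast; linarith⟩
      have hh2 : (2 : ℝ) • h ∈ 𝔞₀ := 𝔞₀.smul_mem _ hh
      obtain ⟨m', V', hm', hgrad', hpair'⟩ := hθ.exists_grading (h𝔞₀neg _ hh2) <|
        hθ.iSup_eigenspace_int_eq_top h𝔞₀neg h𝔞₀abel hh2 fun χ y hy0 hχ => by
          obtain ⟨n, hn⟩ := heven hy0 (hχ ⟨_, hh2⟩)
          exact ⟨_, hn⟩
      have hσθ (a : dualAlgebra θ₁) : T.dualσ (τ a) = a := by
        have hV0 : V 0 = ⊤ := by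
          rw [eq_top_iff]
          intro y _
          rw [hpair.mem_iff, show Z = 0 by simp [Z, hZ0], zero_lie, Int.cast_zero, zero_smul]
        rw [hσV 0 a (hV0 ▸ trivial), zpow_zero, one_smul]
      refine ⟨m', V', (2 : ℝ) • h, τ, hm' (smul_ne_zero two_ne_zero hh0), hgrad', hpair', ?_⟩
      refine eqSigmaZComp_of_iSup_eq_top hθ.1 hgrad'.internal.submodule_iSup_eq_top
        (fun k y hy => (hpair'.mem_iff k y).1 hy) fun k y hy => ?_
      rcases eq_or_ne y 0 with rfl | hy0
      · simp
      obtain ⟨n, hn⟩ := heven hy0 ((hpair'.mem_iff k y).1 hy)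
      rw [hσθ, Int.cast_injective hn, (even_two_mul n).neg_one_zpow, one_smul]
    · refine ⟨m, V, Z, τ, hm ?_, hgrad, hpair, hσ⟩
      exact (toDual hθ₁).map_ne_zero_iff.2 (smul_ne_zero (by simp [Real.pi_ne_zero]) hZ0)
  · exact hm ((toDual hθ₁).map_ne_zero_iff.2 (smul_ne_zero (by simp [Real.pi_ne_zero]) h))
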